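/- Let $N,q\ge 1$ and consider a directed weighted graph on the nodes $0$ (leader) and $1,\dots,N$ (followers), with adjacency weights $a_{ij}\ge 0$, where $a_{ij}>0$ if and only if there is an edge from $j$ to $i$, and $a_{0j}=0$ for all $j$. Let $\mathcal L=\mathrm{diag}\big(\sum_j a_{ij}\big)-(a_{ij})$ be its Laplacian and let $H\in\mathbb R^{N\times N}$ be obtained from $\mathcal L$ by deleting the row and the column of the leader. Assume that there is a directed path from the leader to every follower (i.e. the graph contains a directed spanning tree rooted at the leader), and that there are constants $\varepsilon_1,\varepsilon_2>0$ such that $\varepsilon_1\le|\mathcal L_{ij}|\le\varepsilon_2$ whenever $\mathcal L_{ij}\ne 0$. Let $S\in\mathbb R^{q\times q}$ be a matrix that has no eigenvalues with negative real part and whose entries satisfy $|S_{ij}|\le\epsilon$ for all $i,j$. If $$\mu>\frac{q\,\epsilon\,N\,(2\varepsilon_2)^{N-1}}{\varepsilon_1^{N}},$$ then the matrix $(I_N\otimes S)-\mu\,(H\otimes I_q)$ is Hurwitz, i.e. all its (complex) eigenvalues have negative real part. -/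

import Mathlib

open scoped Kronecker

namespace LeaderFollower

/-- A directed weighted communication graph on one leader, the node `0`, and `N` followers,
the nodes `1, …, N`. The number `weight i j` is the adjacency entry `a_ij`: it is positive
exactly when there is an edge from `j` to `i`, that is, when agent `i` receives information
from agent `j`. The leader receives no information. -/
structure Graph (N : ℕ) where
  weight : Matrix (Fin (N + 1)) (Fin (N + 1)) ℝ
  weight_nonneg : ∀ i j, 0 ≤ weight i j
  leader_row : ∀ j, weight 0 j = 0

namespace Graph

variable {N : ℕ}

/-- `G.Edge j i` says that there is a directed edge from node `j` to node `i`. -/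
def Edge (G : Graph N) (j i : Fin (N + 1)) : Prop :=
  0 < G.weight i j

/-- There is a directed path from `root` to every node, i.e. the graph contains a directed
spanning tree with root `root`. -/
def HasSpanningTreeFrom (G : Graph N) (root : Fin (N + 1)) : Prop :=
  ∀ i, Relation.ReflTransGen G.Edge root i

/-- The Laplacian `D - A`, where `D` is the diagonal matrix of the in-degrees `∑ j, a_ij`. -/
def laplacian (G : Graph N) : Matrix (Fin (N + 1)) (Fin (N + 1)) ℝ :=
  Matrix.diagonal (fun i => ∑ j, G.weight i j) - G.weight

/-- The follower matrix `H`: the Laplacian with the row and column of the leader deleted. -/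
def followerMatrix (G : Graph N) : Matrix (Fin N) (Fin N) ℝ :=
  G.laplacian.submatrix Fin.succ Fin.succ

end Graph

/-- The complex eigenvalues of a real square matrix. -/
def eigenvalues {n : Type*} [Fintype n] [DecidableEq n] (M : Matrix n n ℝ) : Set ℂ :=
  spectrum ℂ (M.map (algebraMap ℝ ℂ))

/-- A real square matrix is Hurwitz if all its complex eigenvalues have negative real part. -/
def IsHurwitz {n : Type*} [Fintype n] [DecidableEq n] (M : Matrix n n ℝ) : Prop :=
  ∀ z ∈ eigenvalues M, z.re < 0

end LeaderFollower

namespace LeaderFollower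

/-! Scaling columns by a positive `w` with `H w ≥ 1` and `w ≤ U`, Gershgorin bounds each row of `I ⊗
S - μ H ⊗ I` by `q ε U - μ < 0`. To build `w`, label nodes by a depth `d ≤ N` that strictly drops
from each follower to some in-neighbour. Let `g 0 = 0`, `ε₁ g (m + 1) = 1 + ε₂ g m` and `u i = g (N
- d i)`. The gain at the in-neighbour outweighs the diagonal term, so the Laplacian of `u` is at
most `-1` at every follower. Laplacian rows sum to zero, so `w = g N - u`, which vanishes at the
leader, satisfies `H w ≥ 1` with `U = g N`. -/

/-- Weighted Gershgorin criterion: a matrix that is strictly diagonally dominant with negative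
diagonal, after scaling the columns by positive weights, is Hurwitz. -/
theorem isHurwitz_of_weighted_diag_dominant {n : Type*} [Fintype n] [DecidableEq n]
    (M : Matrix n n ℝ) (w : n → ℝ) (hw : ∀ i, 0 < w i)
    (h : ∀ i, M i i * w i + ∑ j ∈ Finset.univ.erase i, |M i j| * w j < 0) :
    IsHurwitz M := by
  intro z hz
  by_contra hre
  rw [not_lt] at hre
  rw [eigenvalues, spectrum.mem_iff] at hz
  apply hz
  rw [Matrix.isUnit_iff_isUnit_det, isUnit_iff_ne_zero]
  set B := algebraMap ℂ (Matrix n n ℂ) z - M.map (algebraMap ℝ ℂ) with hB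
  have hdet : (B * Matrix.diagonal fun i => (w i : ℂ)).det ≠ 0 := by
    apply det_ne_zero_of_sum_row_lt_diag
    intro i
    have hdiag : B i i = z - (M i i : ℂ) := by
      simp [hB, Matrix.algebraMap_matrix_apply]
    have hoff : ∀ j ∈ Finset.univ.erase i,
        ‖(B * Matrix.diagonal fun i => (w i : ℂ)) i j‖ = |M i j| * w j := by
      intro j hj
      have hij : i ≠ j := (Finset.ne_of_mem_erase hj).symm
      simp [hB, Matrix.mul_diagonal, Matrix.algebraMap_matrix_apply, hij, abs_of_pos (hw j)]
    rw [Finset.sum_congr rfl hoff, Matrix.mul_diagonal, hdiag, norm_mul, Complex.norm_real,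
      Real.norm_of_nonneg (hw i).le]
    -- Uses `0 ≤ z.re`, the negation of the goal.
    have hnorm : -M i i ≤ ‖z - (M i i : ℂ)‖ := by
      have := Complex.re_le_norm (z - (M i i : ℂ))
      simp only [Complex.sub_re, Complex.ofReal_re] at this
      linarith
    nlinarith [h i, mul_le_mul_of_nonneg_right hnorm (hw i).le]
  rw [Matrix.det_mul] at hdet
  exact left_ne_zero_of_mul hdet

/-- If `∑ j, H i j * w j ≥ 1` for a positive vector `w` bounded by `U`, where `H` has nonpositive
off-diagonal entries, then `I ⊗ S - μ H ⊗ I` is Hurwitz as soon as `μ > q ε U`. -/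
theorem isHurwitz_kronecker_sub {n : Type*} [Fintype n] [DecidableEq n] {q : ℕ}
    (H : Matrix n n ℝ) (S : Matrix (Fin q) (Fin q) ℝ) (w : n → ℝ) {U ε μ : ℝ}
    (hw : ∀ i, 0 < w i) (hwU : ∀ i, w i ≤ U)
    (hH : ∀ i j, i ≠ j → H i j ≤ 0) (hHw : ∀ i, 1 ≤ ∑ j, H i j * w j)
    (hS : ∀ i j, |S i j| ≤ ε) (hμ₀ : 0 < μ) (hμ : q * ε * U < μ) :
    IsHurwitz ((1 : Matrix n n ℝ) ⊗ₖ S - μ • (H ⊗ₖ (1 : Matrix (Fin q) (Fin q) ℝ))) := by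
  apply isHurwitz_of_weighted_diag_dominant _ (fun p => w p.1) (fun p => hw p.1)
  rintro ⟨i, k⟩
  set M := (1 : Matrix n n ℝ) ⊗ₖ S - μ • (H ⊗ₖ (1 : Matrix (Fin q) (Fin q) ℝ)) with hM
  have hMapp : ∀ j l, M (i, k) (j, l) =
      (if i = j then S k l else 0) - μ * (if k = l then H i j else 0) := by
    intro j l
    simp [hM, Matrix.one_apply]
  -- Majorant of the scaled row. Off-diagonal `H i j ≤ 0` gives `|-μ H i j| = -μ H i j`, so the `H`
  -- part sums to exactly `-μ (H w) i`.
  let T : n × Fin q → ℝ := fun p =>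
    ((if i = p.1 then |S k p.2| else 0) - μ * (if k = p.2 then H i p.1 else 0)) * w p.1
  have hoff : ∀ p ∈ Finset.univ.erase (i, k), |M (i, k) p| * w p.1 ≤ T p := by
    rintro ⟨j, l⟩ hp
    have hne := Finset.ne_of_mem_erase hp
    apply mul_le_mul_of_nonneg_right _ (hw j).le
    rw [hMapp]
    by_cases hij : i = j <;> by_cases hkl : k = l
    · exact absurd (by rw [hij, hkl]) hne
    · simp [hij, hkl]
    · simp only [hij, hkl, if_true, if_false, zero_sub, abs_neg, abs_mul]
      rw [abs_of_pos hμ₀, abs_of_nonpos (hH i j hij)]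
      linarith
    · simp [hij, hkl]
  have hdiag : M (i, k) (i, k) * w i ≤ T (i, k) := by
    apply mul_le_mul_of_nonneg_right _ (hw i).le
    rw [hMapp]
    simpa using le_abs_self _
  have hsum : ∑ p, T p = (∑ l, |S k l|) * w i - μ * ∑ j, H i j * w j := by
    simp only [T, sub_mul, Finset.sum_sub_distrib, Fintype.sum_prod_type]
    congr 1
    · rw [Finset.sum_eq_single i (fun j _ hj => by simp [hj.symm]) (by simp)]
      simp [Finset.sum_mul]
    · rw [Finset.mul_sum]
      exact Finset.sum_congr rfl fun j _ => by
        rw [Finset.sum_eq_single k (fun l _ hl => by simp [hl.symm]) (by simp)]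
        simp [mul_assoc]
  have hrow : ∑ l, |S k l| ≤ q * ε := by
    simpa using Finset.sum_le_card_nsmul Finset.univ (fun l => |S k l|) ε (fun l _ => hS k l)
  have hqε : 0 ≤ q * ε := (Finset.sum_nonneg fun l _ => abs_nonneg (S k l)).trans hrow
  calc M (i, k) (i, k) * w i + ∑ p ∈ Finset.univ.erase (i, k), |M (i, k) p| * w p.1
      ≤ T (i, k) + ∑ p ∈ Finset.univ.erase (i, k), T p :=
        add_le_add hdiag (Finset.sum_le_sum hoff)
    _ = (∑ l, |S k l|) * w i - μ * ∑ j, H i j * w j := by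
        rw [Finset.add_sum_erase _ _ (Finset.mem_univ _), hsum]
    _ ≤ q * ε * U - μ * 1 :=
        sub_le_sub (mul_le_mul hrow (hwU i) (hw i).le hqε)
          (mul_le_mul_of_nonneg_left (hHw i) hμ₀.le)
    _ < 0 := by linarith

namespace Graph

variable {N : ℕ}

theorem laplacian_apply_ne (G : Graph N) {i j : Fin (N + 1)} (h : i ≠ j) :
    G.laplacian i j = -G.weight i j := by
  simp [laplacian, h]

theorem sum_laplacian_row (G : Graph N) (i : Fin (N + 1)) : ∑ j, G.laplacian i j = 0 := by
  simp [laplacian, Matrix.diagonal_apply, Finset.sum_sub_distrib]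

/-- Growing a spanning tree from the root one node at a time. -/
theorem exists_partial_depth (G : Graph N) (hG : G.HasSpanningTreeFrom 0) (k : ℕ) (hk : k ≤ N) :
    ∃ (s : Finset (Fin (N + 1))) (d : Fin (N + 1) → ℕ), s.card = k + 1 ∧ 0 ∈ s ∧ d 0 = 0 ∧
      (∀ i ∈ s, d i ≤ k) ∧ ∀ i ∈ s, i ≠ 0 → ∃ j ∈ s, G.Edge j i ∧ d j < d i := by
  induction k with
  | zero => exact ⟨{0}, fun _ => 0, by simp⟩
  | succ k ih =>
    obtain ⟨s, d, hs, h0, hd0, hdk, hpar⟩ := ih (by omega)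
    obtain ⟨j, hj, i, hi, hji⟩ : ∃ j ∈ s, ∃ i ∉ s, G.Edge j i := by
      by_contra! hclosed
      -- A set containing the root and closed under edges is everything, but `s` has only `k + 1 ≤
      -- N` nodes.
      have hall : ∀ i, i ∈ s := fun i => by
        induction hG i with
        | refl => exact h0
        | tail _ hbc ihb => exact by_contra fun hc => hclosed _ ihb _ hc hbc
      have : s = Finset.univ := Finset.eq_univ_iff_forall.2 hall
      simp [this] at hs
      omega
    have hne : ∀ l ∈ s, l ≠ i := fun l hl h => hi (h ▸ hl)
    -- The label is the order of insertion, so it exceeds all earlier ones.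
    refine ⟨insert i s, Function.update d i (k + 1), by rw [Finset.card_insert_of_notMem hi, hs],
      Finset.mem_insert_of_mem h0, by rw [Function.update_of_ne (hne 0 h0), hd0], ?_, ?_⟩
    · intro l hl
      rcases Finset.mem_insert.1 hl with rfl | hl
      · simp
      · rw [Function.update_of_ne (hne l hl)]
        exact (hdk l hl).trans k.le_succ
    · intro l hl hl0
      rcases Finset.mem_insert.1 hl with rfl | hl
      · refine ⟨j, Finset.mem_insert_of_mem hj, hji, ?_⟩
        rw [Function.update_of_ne (hne j hj), Function.update_self]
        exact Nat.lt_succ_of_le (hdk j hj)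
      · obtain ⟨m, hm, hml, hlt⟩ := hpar l hl hl0
        refine ⟨m, Finset.mem_insert_of_mem hm, hml, ?_⟩
        rwa [Function.update_of_ne (hne m hm), Function.update_of_ne (hne l hl)]

/-- A depth function along a spanning tree rooted at the leader. -/
theorem exists_depth (G : Graph N) (hG : G.HasSpanningTreeFrom 0) :
    ∃ d : Fin (N + 1) → ℕ, d 0 = 0 ∧ (∀ i, d i ≤ N) ∧
      ∀ i, i ≠ 0 → ∃ j, G.Edge j i ∧ d j < d i := by
  obtain ⟨s, d, hs, -, hd0, hdN, hpar⟩ := G.exists_partial_depth hG N le_rfl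
  have hall : s = Finset.univ := Finset.eq_univ_of_card s (by simp [hs])
  subst hall
  refine ⟨d, hd0, fun i => hdN i (Finset.mem_univ i), fun i hi => ?_⟩
  obtain ⟨j, -, h⟩ := hpar i (Finset.mem_univ i) hi
  exact ⟨j, h⟩

/-- If a nonnegative potential `u` satisfies `1 + ε₂ u i ≤ ε₁ u j` for some in-neighbour `j ≠ i`
of `i`, then the Laplacian of `u` is at most `-1` at `i`. -/
theorem laplacian_mul_le_neg_one (G : Graph N) (u : Fin (N + 1) → ℝ) (hu : ∀ i, 0 ≤ u i)
    {ε₁ ε₂ : ℝ} {i j : Fin (N + 1)} (hij : i ≠ j) (hw : ε₁ ≤ G.weight i j)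
    (hd : G.laplacian i i ≤ ε₂) (h : 1 + ε₂ * u i ≤ ε₁ * u j) :
    ∑ l, G.laplacian i l * u l ≤ -1 := by
  rw [← Finset.add_sum_erase _ _ (Finset.mem_univ i)]
  have hrest : ∑ l ∈ Finset.univ.erase i, G.laplacian i l * u l ≤ -(G.weight i j * u j) := by
    rw [← Finset.add_sum_erase _ _ (Finset.mem_erase.2 ⟨hij.symm, Finset.mem_univ j⟩),
      G.laplacian_apply_ne hij, neg_mul]
    refine add_le_of_nonpos_right (Finset.sum_nonpos fun l hl => ?_)
    rw [G.laplacian_apply_ne (Finset.ne_of_mem_erase (Finset.mem_of_mem_erase hl)).symm, neg_mul]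
    exact neg_nonpos.2 (mul_nonneg (G.weight_nonneg i l) (hu l))
  have h1 := mul_le_mul_of_nonneg_right hw (hu j)
  have h2 := mul_le_mul_of_nonneg_right hd (hu i)
  linarith

/-- With bounds `ε₁`, `ε₂` on the nonzero Laplacian entries, the follower matrix maps some positive
vector bounded by `(∑ k < N, (ε₂ / ε₁) ^ k) / ε₁` to a vector with entries at least `1`. -/
theorem exists_pos_vector_one_le_followerMatrix_mul (G : Graph N) (hG : G.HasSpanningTreeFrom 0)
    {ε₁ ε₂ : ℝ} (hε₁ : 0 < ε₁) (hε₂ : 0 < ε₂)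
    (hL : ∀ i j, G.laplacian i j ≠ 0 → ε₁ ≤ |G.laplacian i j| ∧ |G.laplacian i j| ≤ ε₂) :
    ∃ w : Fin N → ℝ, (∀ i, 0 < w i) ∧ (∀ i, w i ≤ (∑ k ∈ Finset.range N, (ε₂ / ε₁) ^ k) / ε₁) ∧
      ∀ i, 1 ≤ ∑ j, G.followerMatrix i j * w j := by
  obtain ⟨d, hd0, hdN, hpar⟩ := G.exists_depth hG
  have hr : 0 < ε₂ / ε₁ := div_pos hε₂ hε₁
  set g : ℕ → ℝ := fun m => (∑ k ∈ Finset.range m, (ε₂ / ε₁) ^ k) / ε₁ with hg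
  have hg0 : ∀ m, 0 ≤ g m := fun m => by positivity
  have hgmono : StrictMono g := strictMono_nat_of_lt_succ fun m => by
    simp only [hg]
    rw [Finset.sum_range_succ]
    gcongr
    exact lt_add_of_pos_right _ (pow_pos hr m)
  have hgsucc : ∀ m, ε₁ * g (m + 1) = 1 + ε₂ * g m := fun m => by
    simp only [hg]
    rw [Finset.sum_range_succ', Finset.sum_congr rfl fun k _ => pow_succ (ε₂ / ε₁) k,
      ← Finset.sum_mul]
    field_simp
    ring
  set u : Fin (N + 1) → ℝ := fun i => g (N - d i) with hu
  have hdpos : ∀ i, i ≠ 0 → 0 < d i := fun i hi => by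
    obtain ⟨j, -, hj⟩ := hpar i hi
    omega
  have hLu : ∀ i, i ≠ 0 → ∑ l, G.laplacian i l * u l ≤ -1 := fun i hi => by
    obtain ⟨j, hji, hlt⟩ := hpar i hi
    have hij : i ≠ j := by
      rintro rfl
      exact lt_irrefl _ hlt
    have hwpos : 0 < G.weight i j := hji
    have hLij := G.laplacian_apply_ne hij
    have hw : ε₁ ≤ G.weight i j := by
      have := (hL i j (by rw [hLij]; exact neg_ne_zero.2 hwpos.ne')).1
      rwa [hLij, abs_neg, abs_of_pos hwpos] at this
    have hdiag : G.laplacian i i ≤ ε₂ := by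
      by_cases h : G.laplacian i i = 0
      · rw [h]; exact hε₂.le
      · exact (le_abs_self _).trans (hL i i h).2
    refine G.laplacian_mul_le_neg_one u (fun l => hg0 _) hij hw hdiag ?_
    rw [← hgsucc]
    have hle : N - d i + 1 ≤ N - d j := by have := hdN i; omega
    exact mul_le_mul_of_nonneg_left (hgmono.monotone hle) hε₁.le
  -- Since `u 0 = g N`, deleting the leader's column loses nothing.
  refine ⟨fun i => g N - u i.succ, fun i => ?_, fun i => ?_, fun i => ?_⟩
  · have h1 := hdpos i.succ (Fin.succ_ne_zero i)
    have h2 := hdN i.succ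
    exact sub_pos.2 (hgmono (by omega))
  · exact sub_le_self _ (hg0 _)
  · have hall : ∑ l, G.laplacian i.succ l * (g N - u l) =
        ∑ j, G.followerMatrix i j * (g N - u j.succ) := by
      rw [Fin.sum_univ_succ]
      simp [hu, hd0, followerMatrix]
    rw [← hall]
    simp only [mul_sub, Finset.sum_sub_distrib, ← Finset.sum_mul, G.sum_laplacian_row]
    linarith [hLu i.succ (Fin.succ_ne_zero i)]

/-- If there is at least one follower, the lower bound on the nonzero Laplacian entries does not
exceed the upper bound. -/
theorem lower_le_upper (G : Graph (N + 1)) (hG : G.HasSpanningTreeFrom 0) {ε₁ ε₂ : ℝ}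
    (hL : ∀ i j, G.laplacian i j ≠ 0 → ε₁ ≤ |G.laplacian i j| ∧ |G.laplacian i j| ≤ ε₂) :
    ε₁ ≤ ε₂ := by
  obtain ⟨d, -, -, hpar⟩ := G.exists_depth hG
  obtain ⟨j, hj, hlt⟩ := hpar 1 (by simp)
  have hne : (1 : Fin (N + 1 + 1)) ≠ j := by
    rintro rfl
    exact lt_irrefl _ hlt
  have hwpos : 0 < G.weight 1 j := hj
  have h := hL 1 j (by rw [G.laplacian_apply_ne hne]; exact neg_ne_zero.2 hwpos.ne')
  exact h.1.trans h.2

end Graph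

/-- The ratio is at least `1`, so the last term dominates; the factor `2 ^ N` is pure slack. -/
theorem geom_sum_div_le {N : ℕ} {ε₁ ε₂ : ℝ} (hε₁ : 0 < ε₁) (h : ε₁ ≤ ε₂) :
    (∑ k ∈ Finset.range (N + 1), (ε₂ / ε₁) ^ k) / ε₁ ≤
      ((N + 1 : ℕ) * (2 * ε₂) ^ N) / ε₁ ^ (N + 1) := by
  have hr : 1 ≤ ε₂ / ε₁ := (one_le_div hε₁).2 h
  have hε₂ : 0 < ε₂ := hε₁.trans_le h
  have hsum : ∑ k ∈ Finset.range (N + 1), (ε₂ / ε₁) ^ k ≤ (N + 1 : ℕ) * (ε₂ / ε₁) ^ N := by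
    simpa using Finset.sum_le_card_nsmul (Finset.range (N + 1)) (fun k => (ε₂ / ε₁) ^ k) _
      fun k hk => pow_le_pow_right₀ hr (Nat.lt_succ_iff.1 (Finset.mem_range.1 hk))
  calc (∑ k ∈ Finset.range (N + 1), (ε₂ / ε₁) ^ k) / ε₁
      ≤ (N + 1 : ℕ) * (ε₂ / ε₁) ^ N / ε₁ := by gcongr
    _ = ((N + 1 : ℕ) * ε₂ ^ N) / ε₁ ^ (N + 1) := by
        rw [div_pow, pow_succ ε₁ N]
        field_simp
    _ ≤ ((N + 1 : ℕ) * (2 * ε₂) ^ N) / ε₁ ^ (N + 1) := by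
        gcongr
        linarith

end LeaderFollower

theorem mainTheorem8 (N q : ℕ) (G : LeaderFollower.Graph N) (S : Matrix (Fin q) (Fin q) ℝ)
    (ε₁ ε₂ ε μ : ℝ)
    (hS : ∀ z ∈ LeaderFollower.eigenvalues S, 0 ≤ z.re)
    (hG : G.HasSpanningTreeFrom 0)
    (hε₁ : 0 < ε₁) (hε₂ : 0 < ε₂)
    (hL : ∀ i j, G.laplacian i j ≠ 0 → ε₁ ≤ |G.laplacian i j| ∧ |G.laplacian i j| ≤ ε₂)
    (hSε : ∀ i j, |S i j| ≤ ε)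
    (hμ : (q * ε) * (N * (2 * ε₂) ^ (N - 1)) / ε₁ ^ N < μ) :
    LeaderFollower.IsHurwitz
      ((1 : Matrix (Fin N) (Fin N) ℝ) ⊗ₖ S
        - μ • (G.followerMatrix ⊗ₖ (1 : Matrix (Fin q) (Fin q) ℝ))) := by
  -- For `q = 0` the sign of `ε` is unconstrained, but the product vanishes.
  have hqε : 0 ≤ q * ε := by
    rcases q with _ | q
    · simp
    · exact mul_nonneg (Nat.cast_nonneg _) ((abs_nonneg _).trans (hSε 0 0))
  have hμ₀ : 0 < μ := lt_of_le_of_lt (by positivity) hμ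
  obtain ⟨w, hw, hwU, hHw⟩ := G.exists_pos_vector_one_le_followerMatrix_mul hG hε₁ hε₂ hL
  refine LeaderFollower.isHurwitz_kronecker_sub _ S w hw hwU (fun i j hij => ?_) hHw hSε hμ₀ ?_
  · rw [LeaderFollower.Graph.followerMatrix, Matrix.submatrix_apply,
      G.laplacian_apply_ne ((Fin.succ_injective N).ne hij)]
    exact neg_nonpos.2 (G.weight_nonneg _ _)
  -- Without followers the geometric sum is empty, and `ε₁ ≤ ε₂` may be unavailable.
  · rcases N with _ | N
    · simpa using hμ₀
    · refine lt_of_le_of_lt ?_ hμ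
      rw [mul_div_assoc]
      exact mul_le_mul_of_nonneg_left
        (LeaderFollower.geom_sum_div_le hε₁ (G.lower_le_upper hG hL)) hqε
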